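/- Two proper vertex colourings of a graph are orthogonal if any two distinct vertices that receive the same colour in one of them receive distinct colours in the other. The orthogonal chromatic number $O\chi(G)$ is the least $k$ such that $G$ has a pair of orthogonal proper colourings using colours from a common set of $k$ colours, and a graph $G$ on $n$ vertices is said to have an optimal orthogonal colouring if $O\chi(G)=\lceil\sqrt n\,\rceil$. The random geometric graph $RG(n,r)$ has as vertices $n$ independent uniformly distributed points of the unit square $[0,1]^2$, two of them being adjacent if and only if their Euclidean distance is less than $r$. **Theorem.** Fix $c\in(0,1)$. Let $n\to\infty$ through integers of the form $n=m^2t^2$ with $m=m(n)$ and $t=t(n)$ positive integers, and let $r=r(n)$ be such that $$r\le c\,n^{-1/4}\qquad\text{and}\qquad (\ln n)^4\le t\le \frac{r\,n^{1/2}}{\ln n}.$$ Then asymptotically almost surely $G\sim RG(n,r)$ has an optimal orthogonal colouring; that is, $\mathbb P\big(O\chi(G)=\sqrt n\big)\to 1$ as $n\to\infty$ (note that $\lceil\sqrt n\,\rceil=\sqrt n=mt$). -/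

import Mathlib

open MeasureTheory Filter
open scoped Topology

/-- `G` has an orthogonal colouring with (at most) `k` colours: two proper vertex colourings with
colours from the same palette of size `k`, such that two distinct vertices having the same colour
in the first colouring have distinct colours in the second one. -/
def HasOrthogonalColouring {V : Type*} (G : SimpleGraph V) (k : ℕ) : Prop :=
  ∃ c₁ c₂ : G.Coloring (Fin k), ∀ u v : V, u ≠ v → c₁ u = c₁ v → c₂ u ≠ c₂ v

/-- The orthogonal chromatic number: the least number of colours of an orthogonal colouring. -/
noncomputable def orthogonalChromaticNumber {V : Type*} (G : SimpleGraph V) : ℕ :=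
  sInf {k : ℕ | HasOrthogonalColouring G k}

/-- A finite graph has an orthogonal colouring, so the infimum above is a minimum. -/
theorem hasOrthogonalColouring_card {V : Type*} [Fintype V] (G : SimpleGraph V) :
    HasOrthogonalColouring G (Fintype.card V) := by
  refine ⟨SimpleGraph.Coloring.mk (Fintype.equivFin V) ?_,
    SimpleGraph.Coloring.mk (Fintype.equivFin V) ?_, ?_⟩
  · intro u v h e
    exact h.ne ((Fintype.equivFin V).injective e)
  · intro u v h e
    exact h.ne ((Fintype.equivFin V).injective e)
  · intro u v h e
    exact absurd ((Fintype.equivFin V).injective e) h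

/-- `G` has an optimal orthogonal colouring: its orthogonal chromatic number is `⌈√|V|⌉`. -/
def HasOptimalOrthogonalColouring {V : Type*} [Fintype V] (G : SimpleGraph V) : Prop :=
  orthogonalChromaticNumber G = ⌈Real.sqrt (Fintype.card V : ℝ)⌉₊

/-- The unit square `[0,1]²` in the Euclidean plane. -/
def unitSquare : Set (EuclideanSpace ℝ (Fin 2)) :=
  {p | ∀ i, p i ∈ Set.Icc (0 : ℝ) 1}

/-- The uniform distribution on the unit square. -/
noncomputable def uniformSquare : Measure (EuclideanSpace ℝ (Fin 2)) :=
  volume.restrict unitSquare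

theorem volume_unitSquare : volume unitSquare = 1 := by
  have h : unitSquare = (WithLp.ofLp : EuclideanSpace ℝ (Fin 2) → (Fin 2 → ℝ)) ⁻¹'
      (Set.univ.pi fun _ => Set.Icc (0 : ℝ) 1) := by
    ext p
    simp only [unitSquare, Set.mem_ofPred_eq, Set.mem_preimage, Set.mem_univ_pi]
  rw [h, (PiLp.volume_preserving_ofLp (Fin 2)).measure_preimage
    (MeasurableSet.univ_pi fun _ => measurableSet_Icc).nullMeasurableSet]
  simp [volume_pi_pi, -Set.pi_univ_Icc]

instance instIsProbabilityMeasureUniformSquare : IsProbabilityMeasure uniformSquare :=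
  ⟨by rw [uniformSquare, Measure.restrict_apply_univ, volume_unitSquare]⟩

/-- The joint law of `n` independent uniform points of the unit square. -/
noncomputable def uniformPoints (n : ℕ) : Measure (Fin n → EuclideanSpace ℝ (Fin 2)) :=
  Measure.pi fun _ => uniformSquare

/-- The geometric graph of the points `x 0, …, x (n-1)`: distinct vertices are adjacent iff the
Euclidean distance of their points is less than `r`. For `x` of law `uniformPoints n`, this is the
random geometric graph `RG(n,r)`. -/
def geometricGraph {n : ℕ} (x : Fin n → EuclideanSpace ℝ (Fin 2)) (r : ℝ) :
    SimpleGraph (Fin n) where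
  Adj i j := i ≠ j ∧ dist (x i) (x j) < r
  symm := ⟨fun i j h => ⟨h.1.symm, by rw [dist_comm]; exact h.2⟩⟩
  loopless := ⟨fun _ h => h.1 rfl⟩

/-! Put `N = √n` and scale the square by `N`. If the vertices sit at distinct points `(x, y)` of the
`N × N` grid, so that they fill it, colour them by `x + a y` and `x + (a + 1) y` modulo `N`, with `a
= ⌊√N⌋`. The two colours together determine `y`, then `x`, so the colourings are orthogonal. Each is
proper as long as edges have coordinate differences a little below `√N`, because the lattices `x + b
y ≡ 0` with `b ≈ √N` have no shorter nonzero vectors (`hasOrthogonalColouring_of_grid`). Fewer than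
`N` colours give fewer than `N²` colour pairs.

Edges have scaled length below `r N ≤ c √N`, which leaves room to move each random point by a small
multiple of `√N`. Hence it suffices to match the points bijectively to the grid with displacement
`O(s)`, where `s ≈ ε √N`. In blocks of side about `s`, the excess of points over grid points is the
divergence of a flow controlled by the discrepancies of column prefixes (`exists_flow`). If this
flow is small against the `s²` grid points of a block, Hall's condition holds between neighbouring
blocks (`exists_injective_nearCells`). A prefix has mean `O(s N)`, of order `N^(3/2)`, and may
deviate by order `N`, so Chernoff and a union bound give failure probability at most `4 N² exp(-ρ
√N)`. -/

/-! ### Flows between cells and Hall's theorem -/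

/-- Two cells of the square grid whose indices differ by at most one in each coordinate. -/
def NearCells (a b : ℕ × ℕ) : Prop :=
  a.1 ≤ b.1 + 1 ∧ b.1 ≤ a.1 + 1 ∧ a.2 ≤ b.2 + 1 ∧ b.2 ≤ a.2 + 1

/-- The net flow out of a set `A` of cells is carried by the neighbouring cells outside `A`. -/
theorem sum_divergence_le (K : ℕ) (H V : ℕ → ℕ → ℝ) (h : ℝ)
    (hH : ∀ i ≤ K, ∀ j < K, |H i j| ≤ h) (hV : ∀ i < K, ∀ j ≤ K, |V i j| ≤ h)
    (hH0 : ∀ j, H 0 j = 0) (hHK : ∀ j < K, H K j = 0)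
    (hV0 : ∀ i, V i 0 = 0) (hVK : ∀ i < K, V i K = 0)
    (A B : Finset (ℕ × ℕ)) (hA : A ⊆ Finset.range K ×ˢ Finset.range K)
    (hB : B ⊆ Finset.range K ×ˢ Finset.range K)
    (hAB : ∀ a ∈ A, ∀ b ∈ Finset.range K ×ˢ Finset.range K, NearCells a b → b ∈ B) :
    ∑ a ∈ A, (H (a.1 + 1) a.2 - H a.1 a.2 + (V a.1 (a.2 + 1) - V a.1 a.2))
      ≤ ∑ _b ∈ B \ A, 4 * h := by
  classical
  set S := Finset.range K ×ˢ Finset.range K with hS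
  -- Truncate the flow to the sides of cells of `A`. The divergence is unchanged on `A`, is at least
  -- `-4 * h` on `B \ A`, vanishes outside `B`, and telescopes to zero over the whole grid.
  set G : ℕ → ℕ → ℝ := fun i j => if (i, j) ∈ A ∨ (1 ≤ i ∧ (i - 1, j) ∈ A) then H i j else 0
    with hG
  set W : ℕ → ℕ → ℝ := fun i j => if (i, j) ∈ A ∨ (1 ≤ j ∧ (i, j - 1) ∈ A) then V i j else 0
    with hW
  have key : ∀ b ∈ S, (if b ∈ A then
      (H (b.1 + 1) b.2 - H b.1 b.2 + (V b.1 (b.2 + 1) - V b.1 b.2)) else 0) ≤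
      (if b ∈ B \ A then 4 * h else 0) +
        ((G (b.1 + 1) b.2 - G b.1 b.2) + (W b.1 (b.2 + 1) - W b.1 b.2)) := by
    rintro ⟨i, j⟩ hb
    have hij : i < K ∧ j < K := by simpa [hS] using hb
    by_cases hbA : (i, j) ∈ A
    · simp [hbA, hG, hW]
    · have hH1 := abs_le.1 (hH i hij.1.le j hij.2)
      have hH2 := abs_le.1 (hH (i + 1) hij.1 j hij.2)
      have hV1 := abs_le.1 (hV i hij.1 j hij.2.le)
      have hV2 := abs_le.1 (hV i hij.1 (j + 1) hij.2)
      by_cases hbB : (i, j) ∈ B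
      · simp only [hbA, hbB, hG, hW, Finset.mem_sdiff, if_false, not_false_eq_true, and_self,
          if_true]
        split_ifs <;> linarith
      · have h1 : (i + 1, j) ∉ A := fun h' => hbB (hAB _ h' _ hb (by simp [NearCells]; omega))
        have h2 : ¬ (1 ≤ i ∧ (i - 1, j) ∈ A) := fun h' =>
          hbB (hAB _ h'.2 _ hb (by simp [NearCells]; omega))
        have h3 : (i, j + 1) ∉ A := fun h' => hbB (hAB _ h' _ hb (by simp [NearCells]; omega))
        have h4 : ¬ (1 ≤ j ∧ (i, j - 1) ∈ A) := fun h' =>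
          hbB (hAB _ h'.2 _ hb (by simp [NearCells]; omega))
        simp [hbA, hbB, hG, hW, h1, h2, h3, h4]
  have hsum := Finset.sum_le_sum key
  rw [Finset.sum_add_distrib, Finset.sum_add_distrib, Finset.sum_ite_mem, Finset.sum_ite_mem,
    Finset.inter_eq_right.2 hA, Finset.inter_eq_right.2 (Finset.sdiff_subset.trans hB)] at hsum
  have hGs : ∑ b ∈ S, (G (b.1 + 1) b.2 - G b.1 b.2) = 0 := by
    rw [hS, Finset.sum_product_right]
    refine Finset.sum_eq_zero fun j hj => ?_
    rw [Finset.sum_range_sub (fun i => G i j)]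
    simp [hG, hH0, hHK j (Finset.mem_range.1 hj)]
  have hWs : ∑ b ∈ S, (W b.1 (b.2 + 1) - W b.1 b.2) = 0 := by
    rw [hS, Finset.sum_product]
    refine Finset.sum_eq_zero fun i hi => ?_
    rw [Finset.sum_range_sub (fun j => W i j)]
    simp [hW, hV0, hVK i (Finset.mem_range.1 hi)]
  rw [hGs, hWs] at hsum
  simpa using hsum

/-- If the cell counts of two families of points differ by the divergence of a small flow, then
the first family can be matched into the second one within neighbouring cells. -/
theorem exists_injective_nearCells {P Q : Type*} [Fintype P] [Fintype Q]
    (K : ℕ) (H V : ℕ → ℕ → ℝ) (h : ℝ)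
    (hH : ∀ i ≤ K, ∀ j < K, |H i j| ≤ h) (hV : ∀ i < K, ∀ j ≤ K, |V i j| ≤ h)
    (hH0 : ∀ j, H 0 j = 0) (hHK : ∀ j < K, H K j = 0)
    (hV0 : ∀ i, V i 0 = 0) (hVK : ∀ i < K, V i K = 0)
    (α : P → ℕ × ℕ) (β : Q → ℕ × ℕ) (hα : ∀ p, α p ∈ Finset.range K ×ˢ Finset.range K)
    (hflow : ∀ i < K, ∀ j < K, ((Finset.univ.filter fun p => α p = (i, j)).card : ℝ) -
      (Finset.univ.filter fun q => β q = (i, j)).card =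
        H (i + 1) j - H i j + (V i (j + 1) - V i j))
    (hmass : ∀ i < K, ∀ j < K, 4 * h ≤ (Finset.univ.filter fun q => β q = (i, j)).card) :
    ∃ f : P → Q, Function.Injective f ∧ ∀ p, NearCells (α p) (β (f p)) := by
  classical
  suffices hs : ∀ s : Finset P, s.card ≤
      (s.biUnion fun p => Finset.univ.filter fun q => NearCells (α p) (β q)).card by
    obtain ⟨f, hf, hf'⟩ := (Finset.all_card_le_biUnion_card_iff_exists_injective
      (fun p : P => Finset.univ.filter fun q : Q => NearCells (α p) (β q))).1 hs
    exact ⟨f, hf, fun p => by simpa using hf' p⟩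
  intro s
  set S := Finset.range K ×ˢ Finset.range K with hS
  set A := s.image α with hA
  set B := S.filter (fun b => ∃ a ∈ A, NearCells a b) with hB
  have hAS : A ⊆ S := by
    intro a ha
    obtain ⟨p, -, rfl⟩ := Finset.mem_image.1 ha
    exact hα p
  have hAB : A ⊆ B := fun a ha => by
    rw [hB, Finset.mem_filter]
    exact ⟨hAS ha, a, ha, by simp [NearCells]⟩
  have hBS : B ⊆ S := Finset.filter_subset _ _
  have h1 : s.card ≤ ∑ a ∈ A, (Finset.univ.filter fun p => α p = a).card := by
    rw [Finset.card_eq_sum_card_image α s]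
    exact Finset.sum_le_sum fun a _ =>
      Finset.card_le_card (Finset.filter_subset_filter _ (Finset.subset_univ _))
  have h2 : ∑ b ∈ B, (Finset.univ.filter fun q => β q = b).card ≤
      (s.biUnion fun p => Finset.univ.filter fun q => NearCells (α p) (β q)).card := by
    rw [← Finset.card_biUnion]
    · refine Finset.card_le_card fun q hq => ?_
      simp only [Finset.mem_biUnion, Finset.mem_filter, Finset.mem_univ, true_and] at hq ⊢
      obtain ⟨b, hb, rfl⟩ := hq
      obtain ⟨a, ha, hab⟩ := (Finset.mem_filter.1 hb).2
      obtain ⟨p, hp, rfl⟩ := Finset.mem_image.1 ha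
      exact ⟨p, hp, hab⟩
    · intro b _ b' _ hbb'
      rw [Function.onFun, Finset.disjoint_left]
      intro q hq hq'
      simp only [Finset.mem_filter, Finset.mem_univ, true_and] at hq hq'
      exact hbb' (hq.symm.trans hq')
  -- Hall's condition: the excess of the first family on `A` is the net flow out of `A`, which the
  -- second family's points in `B \ A` can absorb.
  have h3 := sum_divergence_le K H V h hH hV hH0 hHK hV0 hVK A B hAS hBS
    (fun a ha b hb hab => by
      rw [hB, Finset.mem_filter]
      exact ⟨hb, a, ha, hab⟩)
  have h4 : ∑ a ∈ A, (H (a.1 + 1) a.2 - H a.1 a.2 + (V a.1 (a.2 + 1) - V a.1 a.2)) =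
      ∑ a ∈ A, (((Finset.univ.filter fun p => α p = a).card : ℝ) -
        (Finset.univ.filter fun q => β q = a).card) := by
    refine Finset.sum_congr rfl fun a ha => ?_
    have := Finset.mem_product.1 (hAS ha)
    exact (hflow a.1 (Finset.mem_range.1 this.1) a.2 (Finset.mem_range.1 this.2)).symm
  have h5 : ∑ _b ∈ B \ A, 4 * h ≤
      ∑ b ∈ B \ A, ((Finset.univ.filter fun q => β q = b).card : ℝ) := by
    refine Finset.sum_le_sum fun b hb => ?_
    have := Finset.mem_product.1 (hBS (Finset.sdiff_subset hb))
    exact hmass b.1 (Finset.mem_range.1 this.1) b.2 (Finset.mem_range.1 this.2)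
  have h6 := Finset.sum_sdiff (f := fun b => ((Finset.univ.filter fun q => β q = b).card : ℝ)) hAB
  rw [h4, Finset.sum_sub_distrib] at h3
  have h7 : ((s.card : ℕ) : ℝ) ≤ ∑ a ∈ A, ((Finset.univ.filter fun p => α p = a).card : ℝ) := by
    exact_mod_cast h1
  have h8 : ∑ b ∈ B, ((Finset.univ.filter fun q => β q = b).card : ℝ) ≤
      ((s.biUnion fun p => Finset.univ.filter fun q => NearCells (α p) (β q)).card : ℝ) := by
    exact_mod_cast h2
  have h9 : (s.card : ℝ) ≤
      ((s.biUnion fun p => Finset.univ.filter fun q => NearCells (α p) (β q)).card : ℝ) := by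
    linarith
  exact_mod_cast h9

/-- A mass distribution on a `K × K` grid of cells, whose column prefixes are close to those of
the product distribution `T i * T j`, differs from it by the divergence of a small flow. -/
theorem exists_flow (K : ℕ) (T : ℕ → ℝ) (N d : ℝ) (hN : 0 < N) (hT : ∀ i, 0 ≤ T i)
    (hTN : ∑ j ∈ Finset.range K, T j = N) (hTK : ∀ j < K, T j * K ≤ 2 * N)
    (c : ℕ → ℕ → ℝ)
    (hc : ∑ i ∈ Finset.range K, ∑ j ∈ Finset.range K, c i j = N * N)
    (hd : ∀ i < K, ∀ j ≤ K, |∑ l ∈ Finset.range j, (c i l - T i * T l)| ≤ d) :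
    ∃ H V : ℕ → ℕ → ℝ,
      (∀ i ≤ K, ∀ j < K, |H i j| ≤ 2 * d) ∧ (∀ i < K, ∀ j ≤ K, |V i j| ≤ 2 * d) ∧
      (∀ j, H 0 j = 0) ∧ (∀ j < K, H K j = 0) ∧ (∀ i, V i 0 = 0) ∧ (∀ i < K, V i K = 0) ∧
      ∀ i j, c i j - T i * T j = H (i + 1) j - H i j + (V i (j + 1) - V i j) := by
  -- `F i` is the surplus of the first `i` columns. It must cross to column `i`, and is spread over
  -- the rows in proportion to `T j / N`. What remains in each column has total zero and is moved
  -- vertically by integrating it.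
  set D : ℕ → ℕ → ℝ := fun i j => ∑ l ∈ Finset.range j, (c i l - T i * T l) with hD
  set F : ℕ → ℝ := fun i => ∑ l ∈ Finset.range i, D l K with hF
  set B : ℕ → ℝ := fun j => ∑ l ∈ Finset.range j, T l with hB
  have hBK : B K = N := hTN
  have hB1 : ∀ j ≤ K, 0 ≤ B j / N ∧ B j / N ≤ 1 := fun j hj => by
    have h0 : 0 ≤ B j := Finset.sum_nonneg fun l _ => hT l
    have h1 : B j ≤ N := by
      rw [← hTN]
      exact Finset.sum_le_sum_of_subset_of_nonneg (by simpa using hj) fun l _ _ => hT l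
    exact ⟨by positivity, (div_le_one hN).2 h1⟩
  have hFK : F K = 0 := by
    simp only [hF, hD, Finset.sum_sub_distrib, ← Finset.mul_sum, hTN, hc, ← Finset.sum_mul]
    ring
  refine ⟨fun i j => F i * (T j / N), fun i j => D i j - D i K * (B j / N), ?_, ?_, ?_, ?_, ?_,
    ?_, ?_⟩
  · intro i hi j hj
    have hd0 : 0 ≤ d := (abs_nonneg _).trans (hd j hj 0 (Nat.zero_le _))
    have h1 : |F i| ≤ K * d := by
      calc |F i| ≤ ∑ l ∈ Finset.range i, |D l K| := Finset.abs_sum_le_sum_abs _ _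
        _ ≤ ∑ l ∈ Finset.range i, d := Finset.sum_le_sum fun l hl =>
            hd l ((Finset.mem_range.1 hl).trans_le hi) K le_rfl
        _ = i * d := by simp
        _ ≤ K * d := by gcongr
    have h2 : 0 ≤ T j / N := div_nonneg (hT j) hN.le
    rw [abs_mul, abs_of_nonneg h2]
    -- Summing up to `K` columns costs a factor `K`, which spreading over rows of weight at most `2
    -- / K` wins back.
    calc |F i| * (T j / N) ≤ K * d * (T j / N) := by gcongr
      _ = d * (T j * K / N) := by ring
      _ ≤ d * 2 := by
          gcongr
          rw [div_le_iff₀ hN]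
          exact hTK j hj
      _ = 2 * d := by ring
  · intro i hi j hj
    have h1 := hd i hi j hj
    have h2 : |D i K * (B j / N)| ≤ d := by
      rw [abs_mul, abs_of_nonneg (hB1 j hj).1]
      exact (mul_le_of_le_one_right (abs_nonneg _) (hB1 j hj).2).trans (hd i hi K le_rfl)
    calc |D i j - D i K * (B j / N)| ≤ |D i j| + |D i K * (B j / N)| := abs_sub _ _
      _ ≤ 2 * d := by linarith
  · intro j; simp [hF]
  · intro j _; simp [hFK]
  · intro i; simp [hD, hB]
  · intro i _
    simp only [hBK]
    field_simp
    ring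
  · intro i j
    have h1 : F (i + 1) = F i + D i K := Finset.sum_range_succ _ _
    have h2 : D i (j + 1) = D i j + (c i j - T i * T j) := Finset.sum_range_succ _ _
    have h3 : B (j + 1) = B j + T j := Finset.sum_range_succ _ _
    simp only [h1, h2, h3]
    ring

/-! ### Cutting the grid into blocks -/

/-- The index of the block containing `u`, when an interval of integers is cut into `K` blocks of
length `s`, the last of which also gets the remainder. -/
def blockIndex (s K u : ℕ) : ℕ := min (u / s) (K - 1)

theorem blockIndex_lt {s K : ℕ} (hK : 0 < K) (u : ℕ) : blockIndex s K u < K := by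
  unfold blockIndex
  omega

/-- The remainder joined to the last block has fewer than `s` elements, hence the width `2 * s`. -/
theorem blockIndex_bounds {s K N u : ℕ} (hs : 0 < s) (hKN : K = N / s) (hu : u < N) :
    blockIndex s K u * s ≤ u ∧ u < blockIndex s K u * s + 2 * s := by
  have h1 : N < (K + 1) * s := by
    rw [hKN]
    exact Nat.lt_mul_of_div_lt (Nat.lt_succ_self _) hs
  have h2 : u / s * s ≤ u := Nat.div_mul_le_self u s
  have h3 : u < u / s * s + s := Nat.lt_div_mul_add hs
  unfold blockIndex
  rcases le_total (u / s) (K - 1) with h | h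
  · rw [min_eq_left h]
    omega
  · rw [min_eq_right h]
    have h4 : (K - 1) * s ≤ u / s * s := Nat.mul_le_mul_right s h
    rcases Nat.eq_zero_or_pos K with hK | hK
    · subst hK
      simp at h1 ⊢
      omega
    · have h5 : (K + 1) * s = (K - 1) * s + 2 * s := by
        rw [← add_mul]
        congr 1
        omega
      omega

/-- The starting points of the two blocks differ by at most `s`, and a block has width at most `2 *
s`. -/
theorem abs_sub_lt_of_blockIndex {s K N u v : ℕ} (hs : 0 < s) (hKN : K = N / s) (hu : u < N)
    (hv : v < N) (h1 : blockIndex s K u ≤ blockIndex s K v + 1)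
    (h2 : blockIndex s K v ≤ blockIndex s K u + 1) : |(u : ℝ) - v| < 3 * s := by
  have hu' := blockIndex_bounds hs hKN hu
  have hv' := blockIndex_bounds hs hKN hv
  have h3 := Nat.mul_le_mul_right s h1
  have h4 := Nat.mul_le_mul_right s h2
  rw [add_mul, one_mul] at h3 h4
  have h5 : u < v + 3 * s := by omega
  have h6 : v < u + 3 * s := by omega
  have h5' : (u : ℝ) < v + 3 * s := by exact_mod_cast h5
  have h6' : (v : ℝ) < u + 3 * s := by exact_mod_cast h6
  rw [abs_lt]
  constructor <;> linarith

/-- The number of elements of the `i`-th block. -/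
def blockSize (s K N i : ℕ) : ℕ := (Finset.univ.filter fun u : Fin N => blockIndex s K u = i).card

theorem le_blockSize {s K N i : ℕ} (hs : 0 < s) (hKN : K = N / s) (hi : i < K) :
    s ≤ blockSize s K N i := by
  have hKs : K * s ≤ N := hKN ▸ Nat.div_mul_le_self N s
  have hi' : (i + 1) * s ≤ K * s := Nat.mul_le_mul_right s hi
  rw [add_mul, one_mul] at hi'
  have h := Finset.card_le_card_of_injOn (s := (Finset.univ : Finset (Fin s)))
    (t := Finset.univ.filter fun u : Fin N => blockIndex s K u = i)
    (fun x => ⟨i * s + x, by omega⟩) (by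
      intro x _
      have hx : (i * s + x) / s = i := by
        rw [mul_comm i s, Nat.mul_add_div hs, Nat.div_eq_of_lt x.2, add_zero]
      have hx' : blockIndex s K (i * s + x) = i := by
        rw [blockIndex, hx]
        omega
      simpa using hx') (by
      intro x _ y _ hxy
      simp only [Fin.mk.injEq] at hxy
      exact Fin.ext (by omega))
  simpa [blockSize] using h

theorem blockSize_le {s K N i : ℕ} (hs : 0 < s) (hKN : K = N / s) :
    blockSize s K N i ≤ 2 * s := by
  have h := Finset.card_le_card_of_injOn
    (s := Finset.univ.filter fun u : Fin N => blockIndex s K u = i)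
    (t := Finset.Ico (i * s) (i * s + 2 * s)) (fun u => (u : ℕ)) (by
      intro u hu
      have hu' : blockIndex s K u = i := by simpa using hu
      have := blockIndex_bounds hs hKN u.2
      rw [hu'] at this
      simpa using this) (fun x _ y _ hxy => Fin.ext hxy)
  simpa [blockSize] using h

theorem sum_blockSize (s K N j : ℕ) : ∑ l ∈ Finset.range j, blockSize s K N l =
    (Finset.univ.filter fun u : Fin N => blockIndex s K u < j).card := by
  rw [Finset.card_eq_sum_card_fiberwise (f := fun u : Fin N => blockIndex s K u)
    (t := Finset.range j) (by intro u hu; simpa using hu)]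
  refine Finset.sum_congr rfl fun l hl => ?_
  rw [blockSize, Finset.filter_filter]
  congr 1
  ext u
  have := Finset.mem_range.1 hl
  simp only [Finset.mem_filter, Finset.mem_univ, true_and]
  omega

/-- `N ^ 2` points of the `N × N` grid whose counts in all bottom parts of the columns of blocks
are nearly right can be spread bijectively over the grid by moving each of them a little. -/
theorem exists_injective_close {P : Type*} [Fintype P] {N s K : ℕ} (hN : 0 < N) (hs : 0 < s)
    (hK : 0 < K) (hKN : K = N / s) (hP : Fintype.card P = N ^ 2) (U : P → Fin N × Fin N) (d : ℝ)
    (hds : 8 * d ≤ (s : ℝ) ^ 2)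
    (hd : ∀ i < K, ∀ j ≤ K,
      |((Finset.univ.filter fun p => blockIndex s K (U p).1 = i ∧ blockIndex s K (U p).2 < j).card
        : ℝ) - blockSize s K N i * (Finset.univ.filter fun v : Fin N => blockIndex s K v < j).card|
        ≤ d) :
    ∃ f : P → Fin N × Fin N, Function.Injective f ∧
      ∀ p, |(((U p).1 : ℕ) : ℝ) - ((f p).1 : ℕ)| < 3 * s ∧
        |(((U p).2 : ℕ) : ℝ) - ((f p).2 : ℕ)| < 3 * s := by
  classical
  set g : Fin N × Fin N → ℕ × ℕ := fun q => (blockIndex s K q.1, blockIndex s K q.2) with hg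
  have hgS : ∀ q, g q ∈ Finset.range K ×ˢ Finset.range K := fun q => by
    simp [hg, blockIndex_lt hK]
  set c : ℕ → ℕ → ℝ := fun i j => (Finset.univ.filter fun p => g (U p) = (i, j)).card with hc
  have hcard : ∀ i j, (Finset.univ.filter fun q => g q = (i, j)).card =
      blockSize s K N i * blockSize s K N j := fun i j => by
    rw [blockSize, blockSize, ← Finset.card_product]
    congr 1
    ext q
    simp [hg]
  have hprefix : ∀ i j, ∑ l ∈ Finset.range j, c i l = (Finset.univ.filter fun p =>
      blockIndex s K (U p).1 = i ∧ blockIndex s K (U p).2 < j).card := fun i j => by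
    rw [Finset.card_eq_sum_card_fiberwise (f := fun p => blockIndex s K (U p).2)
      (t := Finset.range j) (by intro u hu; simpa using (by simpa using hu : _ ∧ _).2)]
    push_cast
    refine Finset.sum_congr rfl fun l hl => ?_
    simp only [hc]
    rw [Finset.filter_filter]
    congr 2
    ext p
    have := Finset.mem_range.1 hl
    simp only [hg, Finset.mem_filter, Finset.mem_univ, true_and, Prod.mk.injEq]
    omega
  have htotal : ∑ i ∈ Finset.range K, ∑ j ∈ Finset.range K, c i j = (N : ℝ) * N := by
    have h1 : Fintype.card P = ∑ a ∈ Finset.range K ×ˢ Finset.range K,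
        (Finset.univ.filter fun p => g (U p) = a).card := by
      rw [← Finset.card_univ]
      exact Finset.card_eq_sum_card_fiberwise fun p _ => hgS (U p)
    rw [← Finset.sum_product', ← sq]
    simp only [hc, Prod.mk.eta]
    exact_mod_cast (h1.symm.trans hP)
  have hTN : ∑ j ∈ Finset.range K, (blockSize s K N j : ℝ) = N := by
    rw [← Nat.cast_sum, sum_blockSize]
    simp [blockIndex_lt hK]
  have hKs : K * s ≤ N := hKN ▸ Nat.div_mul_le_self N s
  obtain ⟨H, V, hH, hV, hH0, hHK, hV0, hVK, hflow⟩ := exists_flow K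
    (fun i => (blockSize s K N i : ℝ)) N d (by exact_mod_cast hN) (fun i => Nat.cast_nonneg _) hTN
    (fun j _ => by
      have : blockSize s K N j * K ≤ 2 * N :=
        calc blockSize s K N j * K ≤ 2 * s * K := Nat.mul_le_mul_right K (blockSize_le hs hKN)
          _ = 2 * (K * s) := by ring
          _ ≤ 2 * N := by omega
      exact_mod_cast this) c htotal
    (fun i hi j hj => by
      have := hd i hi j hj
      rw [Finset.sum_sub_distrib, hprefix, ← Finset.mul_sum, ← Nat.cast_sum, sum_blockSize]
      exact this)
  -- The target is the grid itself, whose block counts are exactly the products of block sizes. The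
  -- flow is bounded by `2 * d`, so a block must hold `8 * d` grid points; it holds at least `s ^
  -- 2`.
  obtain ⟨f, hf, hnear⟩ := exists_injective_nearCells K H V (2 * d) hH hV hH0 hHK hV0 hVK
    (fun p => g (U p)) g (fun p => hgS _)
    (fun i _ j _ => by rw [← hflow i j, hcard]; push_cast; rfl)
    (fun i hi j hj => by
      rw [hcard]
      push_cast
      have h1 : (s : ℝ) ≤ blockSize s K N i := by exact_mod_cast le_blockSize hs hKN hi
      have h2 : (s : ℝ) ≤ blockSize s K N j := by exact_mod_cast le_blockSize hs hKN hj
      have h3 : (s : ℝ) ^ 2 ≤ blockSize s K N i * blockSize s K N j := by rw [sq]; gcongr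
      linarith)
  refine ⟨f, hf, fun p => ?_⟩
  obtain ⟨h1, h2, h3, h4⟩ := hnear p
  exact ⟨abs_sub_lt_of_blockIndex hs hKN (U p).1.2 (f p).1.2 h1 h2,
    abs_sub_lt_of_blockIndex hs hKN (U p).2.2 (f p).2.2 h3 h4⟩

/-! ### Linear colourings modulo `N` -/

/-- The lattice `{(x, y) | x + b y ≡ 0 mod N}` has no short nonzero vectors if `b ≈ √N`. -/
theorem eq_zero_of_dvd_add_mul {N a : ℕ} {b x y : ℤ} {L : ℝ} (hb : b = a ∨ b = a + 1)
    (hLa : L < a) (hLN : L * (a + 2) < N) (hx : |(x : ℝ)| ≤ L) (hy : |(y : ℝ)| ≤ L)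
    (hdvd : (N : ℤ) ∣ x + b * y) : x = 0 ∧ y = 0 := by
  have hbR : (a : ℝ) ≤ b ∧ (b : ℝ) ≤ a + 1 := by
    rcases hb with rfl | rfl <;> simp
  have ha0 : (0 : ℝ) ≤ a := Nat.cast_nonneg a
  -- The second bound on `L` makes `x + b * y` smaller than `N`, so the congruence is an equality.
  -- Then `y ≠ 0` would force `|x| ≥ a > L`.
  have h0 : x + b * y = 0 := by
    refine Int.eq_zero_of_abs_lt_dvd hdvd ?_
    have : |((x + b * y : ℤ) : ℝ)| < N := by
      push_cast
      calc |(x : ℝ) + b * y| ≤ |(x : ℝ)| + |(b : ℝ) * y| := abs_add_le _ _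
        _ = |(x : ℝ)| + b * |(y : ℝ)| := by rw [abs_mul, abs_of_nonneg (ha0.trans hbR.1)]
        _ ≤ L + (a + 1) * L := by
            have := mul_le_mul hbR.2 hy (abs_nonneg _) (by linarith)
            linarith
        _ = L * (a + 2) := by ring
        _ < N := hLN
    exact_mod_cast this
  have hy0 : y = 0 := by
    by_contra hne
    have h1 : (1 : ℝ) ≤ |(y : ℝ)| := by exact_mod_cast Int.one_le_abs hne
    have h2 : (x : ℝ) = -(b * y) := by
      have : x = -(b * y) := by linarith
      exact_mod_cast this
    rw [h2, abs_neg, abs_mul, abs_of_nonneg (ha0.trans hbR.1)] at hx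
    have := mul_le_mul hbR.1 h1 zero_le_one (ha0.trans hbR.1)
    linarith
  exact ⟨by simpa [hy0] using h0, hy0⟩

/-- A graph whose vertices can be placed at distinct points of the `N × N` grid with all edges
short has an orthogonal colouring with `N` colours. -/
theorem hasOrthogonalColouring_of_grid {V : Type*} (G : SimpleGraph V) {N a : ℕ} (hN : 0 < N)
    {L : ℝ} (hLa : L < a) (hLN : L * (a + 2) < N) (f : V → Fin N × Fin N)
    (hf : Function.Injective f)
    (hadj : ∀ u v, G.Adj u v → |(((f u).1 : ℕ) : ℝ) - ((f v).1 : ℕ)| ≤ L ∧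
      |(((f u).2 : ℕ) : ℝ) - ((f v).2 : ℕ)| ≤ L) :
    HasOrthogonalColouring G N := by
  have : NeZero N := ⟨hN.ne'⟩
  let e : ZMod N ≃ Fin N := (ZMod.finEquiv N).symm.toEquiv
  let col : ℤ → V → ZMod N := fun b v => (((f v).1 : ℕ) : ZMod N) + b * (((f v).2 : ℕ) : ZMod N)
  have hproper : ∀ b : ℤ, (b = a ∨ b = a + 1) → ∀ {u v}, G.Adj u v → e (col b u) ≠ e (col b v) := by
    intro b hb u v huv heq
    have h1 : col b u = col b v := e.injective heq
    have h2 : (N : ℤ) ∣ (((f u).1 : ℕ) - ((f v).1 : ℕ) : ℤ) +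
        b * (((f u).2 : ℕ) - ((f v).2 : ℕ) : ℤ) := by
      rw [← ZMod.intCast_zmod_eq_zero_iff_dvd]
      simp only [col] at h1
      push_cast
      linear_combination h1
    have h3 := eq_zero_of_dvd_add_mul (L := L) hb hLa hLN
      (by push_cast; exact (hadj u v huv).1) (by push_cast; exact (hadj u v huv).2) h2
    refine huv.ne (hf (Prod.ext (Fin.ext ?_) (Fin.ext ?_)))
    · have := h3.1; omega
    · have := h3.2; omega
  refine ⟨SimpleGraph.Coloring.mk (fun v => e (col a v)) (hproper a (Or.inl rfl)),
    SimpleGraph.Coloring.mk (fun v => e (col (a + 1) v)) (hproper (a + 1) (Or.inr rfl)), ?_⟩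
  intro u v huv h1 h2
  have h1' : col a u = col a v := e.injective h1
  have h2' : col (a + 1) u = col (a + 1) v := e.injective h2
  simp only [col] at h1' h2'
  push_cast at h1' h2'
  -- The slopes differ by one, so subtracting the colours recovers `y` for every `N`, without any
  -- invertibility assumption.
  have h3 : (((f u).2 : ℕ) : ZMod N) = (((f v).2 : ℕ) : ZMod N) := by
    linear_combination h2' - h1'
  have h4 : (((f u).1 : ℕ) : ZMod N) = (((f v).1 : ℕ) : ZMod N) := by
    linear_combination h1' - a * h3
  have hinj : ∀ x y : Fin N, ((x : ℕ) : ZMod N) = ((y : ℕ) : ZMod N) → x = y := by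
    intro x y hxy
    rw [ZMod.natCast_eq_natCast_iff', Nat.mod_eq_of_lt x.2, Nat.mod_eq_of_lt y.2] at hxy
    exact Fin.ext hxy
  exact huv (hf (Prod.ext (hinj _ _ h4) (hinj _ _ h3)))

/-- An orthogonal colouring with `k` colours distinguishes the vertices by pairs of colours. -/
theorem HasOrthogonalColouring.card_le {V : Type*} [Fintype V] {G : SimpleGraph V} {k : ℕ}
    (h : HasOrthogonalColouring G k) : Fintype.card V ≤ k ^ 2 := by
  obtain ⟨c₁, c₂, hc⟩ := h
  have hinj : Function.Injective fun v => (c₁ v, c₂ v) := by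
    intro u v huv
    by_contra hne
    exact hc u v hne (congrArg Prod.fst huv) (congrArg Prod.snd huv)
  simpa [sq] using Fintype.card_le_of_injective _ hinj

/-- For a square number of vertices the counting bound `N ^ 2 ≤ k ^ 2` is already the matching lower
bound. -/
theorem hasOptimalOrthogonalColouring_of_sq {V : Type*} [Fintype V] {G : SimpleGraph V} {N : ℕ}
    (hV : Fintype.card V = N ^ 2) (h : HasOrthogonalColouring G N) :
    HasOptimalOrthogonalColouring G := by
  have h1 : ⌈Real.sqrt (Fintype.card V : ℝ)⌉₊ = N := by
    rw [hV, Nat.cast_pow, Real.sqrt_sq (Nat.cast_nonneg _), Nat.ceil_natCast]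
  rw [HasOptimalOrthogonalColouring, h1, orthogonalChromaticNumber]
  refine le_antisymm (Nat.sInf_le h) (le_csInf ⟨N, h⟩ fun k hk => ?_)
  have := HasOrthogonalColouring.card_le hk
  rw [hV] at this
  exact (Nat.pow_le_pow_iff_left two_ne_zero).1 this

/-! ### Concentration of counts -/

/-- Chernoff bound for the number of independent points with a given property. -/
theorem measureReal_pi_count_le {E : Type*} [MeasurableSpace E] (μ : Measure E)
    [IsProbabilityMeasure μ] (q : E → Prop) [DecidablePred q] (hq : MeasurableSet {z | q z})
    (n : ℕ) (lam b : ℝ) (hlam : |lam| ≤ 1) :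
    (Measure.pi fun _ : Fin n => μ).real {x | b ≤ lam *
      ((Finset.univ.filter fun i => q (x i)).card - n * μ.real {z | q z})} ≤
      Real.exp (-b + n * μ.real {z | q z} * lam ^ 2) := by
  set p := μ.real {z | q z} with hp
  -- This is `exp (lam * 1_q)`, written so that its integral is immediate. By independence the
  -- exponential moment of the count is the `n`-th power of that integral.
  set h : E → ℝ := fun z => 1 + {z | q z}.indicator (fun _ => Real.exp lam - 1) z with hh
  have hind : Integrable ({z | q z}.indicator (fun _ => Real.exp lam - 1)) μ :=
    (integrable_const _).indicator hq
  have hint : ∫ z, h z ∂μ = 1 + p * (Real.exp lam - 1) := by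
    rw [hh, integral_add (integrable_const _) hind, integral_indicator_const _ hq]
    simp [hp]
  -- Valid for both signs of `lam`, so one lemma serves both tails.
  have hexp : Real.exp lam - 1 ≤ lam + lam ^ 2 := by
    have := (abs_le.1 (Real.abs_exp_sub_one_sub_id_le hlam)).2
    linarith
  have hle : ∫ z, h z ∂μ ≤ Real.exp (p * (lam + lam ^ 2)) := by
    rw [hint]
    have h1 : p * (Real.exp lam - 1) ≤ p * (lam + lam ^ 2) :=
      mul_le_mul_of_nonneg_left hexp measureReal_nonneg
    have h2 := Real.add_one_le_exp (p * (lam + lam ^ 2))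
    linarith
  have hval : ∀ z, h z = if q z then Real.exp lam else 1 := fun z => by
    by_cases hz : q z <;> simp [hh, Set.indicator, hz]
  have hpos : ∀ z, 0 ≤ h z := fun z => by
    rw [hval]
    split_ifs <;> positivity
  have hprod : ∀ x : Fin n → E, ∏ i, h (x i) =
      Real.exp (lam * (Finset.univ.filter fun i => q (x i)).card) := fun x => by
    simp only [hval]
    rw [Finset.prod_ite, Finset.prod_const, Finset.prod_const_one, mul_one, ← Real.exp_nat_mul,
      mul_comm]
  have hmarkov := mul_meas_ge_le_integral_of_nonneg
    (μ := Measure.pi fun _ : Fin n => μ) (f := fun x => ∏ i, h (x i))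
    (Eventually.of_forall fun x => Finset.prod_nonneg fun i _ => hpos _)
    (Integrable.fintype_prod (f := fun _ => h) fun _ => (integrable_const _).add hind)
    (Real.exp (b + lam * (n * p)))
  rw [integral_fintype_prod_eq_pow, Fintype.card_fin] at hmarkov
  have hset : {x : Fin n → E | Real.exp (b + lam * (n * p)) ≤ ∏ i, h (x i)} = {x | b ≤ lam *
      ((Finset.univ.filter fun i => q (x i)).card - n * p)} := by
    ext x
    simp only [Set.mem_ofPred_eq, hprod, Real.exp_le_exp]
    constructor <;> intro hx <;> linarith
  rw [hset] at hmarkov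
  have hpow : (∫ z, h z ∂μ) ^ n ≤ Real.exp (n * (p * (lam + lam ^ 2))) := by
    rw [Real.exp_nat_mul]
    exact pow_le_pow_left₀ (integral_nonneg hpos) hle n
  have hfin := hmarkov.trans hpow
  rw [← le_div_iff₀' (Real.exp_pos _), ← Real.exp_sub] at hfin
  refine hfin.trans_eq ?_
  congr 1
  ring

/-- Two-sided Chernoff bound for the number of independent points with a given property. -/
theorem measureReal_pi_abs_count_le {E : Type*} [MeasurableSpace E] (μ : Measure E)
    [IsProbabilityMeasure μ] (q : E → Prop) [DecidablePred q] (hq : MeasurableSet {z | q z})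
    (n : ℕ) (lam d : ℝ) (hlam0 : 0 < lam) (hlam : lam ≤ 1) :
    (Measure.pi fun _ : Fin n => μ).real {x | d <
      |((Finset.univ.filter fun i => q (x i)).card : ℝ) - n * μ.real {z | q z}|} ≤
      2 * Real.exp (-(lam * d) + n * μ.real {z | q z} * lam ^ 2) := by
  have h1 := measureReal_pi_count_le μ q hq n lam (lam * d)
    (by rwa [abs_of_pos hlam0])
  have h2 := measureReal_pi_count_le μ q hq n (-lam) (lam * d)
    (by rwa [abs_neg, abs_of_pos hlam0])
  rw [neg_sq] at h2
  rw [two_mul]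
  refine le_trans ?_ (add_le_add h1 h2)
  refine (measureReal_mono ?_).trans (measureReal_union_le _ _)
  intro x hx
  rw [Set.mem_ofPred_eq, lt_abs] at hx
  rcases hx with hx | hx
  · left
    exact mul_le_mul_of_nonneg_left hx.le hlam0.le
  · right
    show lam * d ≤ -lam * _
    rw [neg_mul, ← mul_neg]
    exact mul_le_mul_of_nonneg_left hx.le hlam0.le

/-! ### Rounding uniform points to the grid -/

/-- The index of the interval containing `x`, when `[0,1]` is cut into `N` equal intervals. -/
noncomputable def gridIndex (N : ℕ) (x : ℝ) : ℕ := min ⌊x * N⌋₊ (N - 1)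

theorem gridIndex_lt {N : ℕ} (hN : 0 < N) (x : ℝ) : gridIndex N x < N := by
  unfold gridIndex
  omega

theorem measurable_gridIndex (N : ℕ) : Measurable (gridIndex N) :=
  (Nat.measurable_floor.comp (measurable_id.mul_const _)).min measurable_const

/-- The endpoint `x = 1` is put into the last interval, so the upper bound cannot be strict. -/
theorem gridIndex_bounds {N : ℕ} (hN : 0 < N) {x : ℝ} (hx : x ∈ Set.Icc (0 : ℝ) 1) :
    (gridIndex N x : ℝ) ≤ x * N ∧ x * N ≤ gridIndex N x + 1 := by
  have h0 : 0 ≤ x * N := mul_nonneg hx.1 (Nat.cast_nonneg _)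
  have h1 : x * N ≤ N := mul_le_of_le_one_left (Nat.cast_nonneg _) hx.2
  constructor
  · exact (Nat.cast_le.2 (min_le_left _ _)).trans (Nat.floor_le h0)
  · unfold gridIndex
    rcases le_total ⌊x * N⌋₊ (N - 1) with h | h
    · rw [min_eq_left h]
      exact (Nat.lt_floor_add_one _).le
    · rw [min_eq_right h]
      have : ((N - 1 : ℕ) : ℝ) + 1 = N := by
        exact_mod_cast Nat.sub_add_cancel hN
      rwa [this]

/-- The fibre lies between a half-open and a closed interval of length `1 / N`. -/
theorem volume_gridIndex_eq {N : ℕ} (hN : 0 < N) {a : ℕ} (ha : a < N) :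
    volume ({x | gridIndex N x = a} ∩ Set.Icc (0 : ℝ) 1) = ENNReal.ofReal (1 / N) := by
  have hN' : (0 : ℝ) < N := by exact_mod_cast hN
  have hlen : ((a : ℝ) + 1) / N - a / N = 1 / N := by ring
  apply le_antisymm
  · rw [← hlen, ← Real.volume_Icc]
    refine measure_mono ?_
    rintro x ⟨rfl, hx⟩
    have h := gridIndex_bounds hN hx
    exact ⟨(div_le_iff₀ hN').2 h.1, (le_div_iff₀ hN').2 h.2⟩
  · rw [← hlen, ← Real.volume_Ico]
    refine measure_mono ?_
    rintro x ⟨h1, h2⟩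
    have h1' := (div_le_iff₀ hN').1 h1
    have h2' := (lt_div_iff₀ hN').1 h2
    refine ⟨?_, le_trans (by positivity) h1, h2.le.trans ((div_le_one hN').2 (by exact_mod_cast ha))⟩
    have hfl : ⌊x * N⌋₊ = a := (Nat.floor_eq_iff (by linarith [(Nat.cast_nonneg a : (0 : ℝ) ≤ a)])).2
      ⟨h1', h2'⟩
    rw [Set.mem_ofPred_eq, gridIndex, hfl]
    omega

theorem volume_gridIndex {N : ℕ} (hN : 0 < N) (q : ℕ → Prop) [DecidablePred q] :
    volume ({x | q (gridIndex N x)} ∩ Set.Icc (0 : ℝ) 1) =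
      ENNReal.ofReal ((Finset.univ.filter fun u : Fin N => q u).card / N) := by
  have hset : {x | q (gridIndex N x)} ∩ Set.Icc (0 : ℝ) 1 =
      ⋃ u ∈ Finset.univ.filter fun u : Fin N => q u,
        ({x | gridIndex N x = u} ∩ Set.Icc (0 : ℝ) 1) := by
    ext x
    simp only [Set.mem_inter_iff, Set.mem_ofPred_eq, Set.mem_iUnion, Finset.mem_filter,
      Finset.mem_univ, true_and, exists_prop]
    constructor
    · rintro ⟨h1, h2⟩
      exact ⟨⟨_, gridIndex_lt hN x⟩, h1, rfl, h2⟩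
    · rintro ⟨u, h1, h2, h3⟩
      exact ⟨h2 ▸ h1, h3⟩
  rw [hset, measure_biUnion_finset, Finset.sum_congr rfl fun u _ => volume_gridIndex_eq hN u.2,
    Finset.sum_const, nsmul_eq_mul, ← ENNReal.ofReal_natCast,
    ← ENNReal.ofReal_mul (Nat.cast_nonneg _), mul_one_div]
  · intro u _ v _ huv
    rw [Function.onFun, Set.disjoint_left]
    rintro x ⟨h1, -⟩ ⟨h2, -⟩
    exact huv (Fin.ext (h1.symm.trans h2))
  · intro u _
    exact (measurable_gridIndex N (measurableSet_singleton (u : ℕ))).inter measurableSet_Icc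

theorem measurableSet_gridIndex (N : ℕ) (q q' : ℕ → Prop) :
    MeasurableSet {z : EuclideanSpace ℝ (Fin 2) | q (gridIndex N (z 0)) ∧ q' (gridIndex N (z 1))} := by
  have h : ∀ i : Fin 2, Measurable fun z : EuclideanSpace ℝ (Fin 2) => gridIndex N (z i) :=
    fun i => (measurable_gridIndex N).comp (by fun_prop)
  exact (h 0 (MeasurableSet.of_discrete (s := {a | q a}))).inter
    (h 1 (MeasurableSet.of_discrete (s := {a | q' a})))

/-- The grid square containing a uniform point of the unit square is uniformly distributed. -/
theorem uniformSquare_gridIndex {N : ℕ} (hN : 0 < N) (q q' : ℕ → Prop) [DecidablePred q]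
    [DecidablePred q'] :
    uniformSquare.real {z | q (gridIndex N (z 0)) ∧ q' (gridIndex N (z 1))} =
      ((Finset.univ.filter fun u : Fin N => q u).card / N) *
        ((Finset.univ.filter fun u : Fin N => q' u).card / N) := by
  have hset : {z : EuclideanSpace ℝ (Fin 2) | q (gridIndex N (z 0)) ∧ q' (gridIndex N (z 1))} ∩
      unitSquare = (WithLp.ofLp : EuclideanSpace ℝ (Fin 2) → (Fin 2 → ℝ)) ⁻¹'
      (Set.univ.pi ![{x | q (gridIndex N x)} ∩ Set.Icc (0 : ℝ) 1,
        {x | q' (gridIndex N x)} ∩ Set.Icc (0 : ℝ) 1]) := by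
    ext z
    simp only [unitSquare, Set.mem_inter_iff, Set.mem_ofPred_eq, Set.mem_preimage,
      Set.mem_univ_pi, Fin.forall_fin_two, Matrix.cons_val_zero, Matrix.cons_val_one]
    tauto
  have hm : ∀ (q : ℕ → Prop), MeasurableSet ({x | q (gridIndex N x)} ∩ Set.Icc (0 : ℝ) 1) :=
    fun q => (measurable_gridIndex N (MeasurableSet.of_discrete (s := {a | q a}))).inter
      measurableSet_Icc
  rw [measureReal_def, uniformSquare, Measure.restrict_apply (measurableSet_gridIndex N q q'), hset,
    (PiLp.volume_preserving_ofLp (Fin 2)).measure_preimage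
    (MeasurableSet.univ_pi (by
      rw [Fin.forall_fin_two]
      exact ⟨hm q, hm q'⟩)).nullMeasurableSet, volume_pi_pi, Fin.prod_univ_two]
  simp only [Matrix.cons_val_zero, Matrix.cons_val_one]
  rw [volume_gridIndex hN, volume_gridIndex hN, ENNReal.toReal_mul,
    ENNReal.toReal_ofReal (by positivity), ENNReal.toReal_ofReal (by positivity)]

theorem measurableSet_unitSquare : MeasurableSet unitSquare := by
  have : unitSquare = ⋂ i, {p : EuclideanSpace ℝ (Fin 2) | p i ∈ Set.Icc (0 : ℝ) 1} := by
    ext p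
    simp [unitSquare]
  rw [this]
  refine MeasurableSet.iInter fun i => ?_
  have h : Measurable fun p : EuclideanSpace ℝ (Fin 2) => p i := by fun_prop
  exact h measurableSet_Icc

theorem ae_uniformPoints_mem (n : ℕ) : ∀ᵐ x ∂uniformPoints n, ∀ p, x p ∈ unitSquare := by
  refine eventually_all.2 fun p => ?_
  exact (Measure.tendsto_eval_ae_ae (μ := fun _ : Fin n => uniformSquare) (i := p)).eventually
    (ae_restrict_mem measurableSet_unitSquare)

instance instIsProbabilityMeasureUniformPoints (n : ℕ) : IsProbabilityMeasure (uniformPoints n) := by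
  unfold uniformPoints
  infer_instance

/-! ### Equidistribution and the choice of constants -/

/-- With high probability all bottom parts of columns of blocks contain about the right number of
random points. -/
theorem uniformPoints_real_discrepancy_le {N s K n : ℕ} (hN : 0 < N) (hs : 0 < s)
    (hKN : K = N / s) (hn : n = N ^ 2) (lam d : ℝ) (hlam0 : 0 < lam) (hlam : lam ≤ 1) :
    (uniformPoints n).real {x | ¬ ∀ i < K, ∀ j ≤ K,
      |((Finset.univ.filter fun p => blockIndex s K (gridIndex N (x p 0)) = i ∧
        blockIndex s K (gridIndex N (x p 1)) < j).card : ℝ) -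
        blockSize s K N i * (Finset.univ.filter fun v : Fin N => blockIndex s K v < j).card|
        ≤ d} ≤ K * ((K + 1) * (2 * Real.exp (-(lam * d) + 2 * s * N * lam ^ 2))) := by
  have hN' : (0 : ℝ) < N := by exact_mod_cast hN
  set bad : ℕ → ℕ → Set (Fin n → EuclideanSpace ℝ (Fin 2)) := fun i j =>
    {x | d < |((Finset.univ.filter fun p => blockIndex s K (gridIndex N (x p 0)) = i ∧
        blockIndex s K (gridIndex N (x p 1)) < j).card : ℝ) -
        blockSize s K N i * (Finset.univ.filter fun v : Fin N => blockIndex s K v < j).card|}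
    with hbad
  have hone : ∀ i j, (uniformPoints n).real (bad i j) ≤
      2 * Real.exp (-(lam * d) + 2 * s * N * lam ^ 2) := by
    intro i j
    have h := measureReal_pi_abs_count_le uniformSquare
      (fun z : EuclideanSpace ℝ (Fin 2) => blockIndex s K (gridIndex N (z 0)) = i ∧
        blockIndex s K (gridIndex N (z 1)) < j)
      (measurableSet_gridIndex N (fun u => blockIndex s K u = i) (fun u => blockIndex s K u < j))
      n lam d hlam0 hlam
    -- Block boundaries are grid lines and `n = N ^ 2`, so the mean is exactly the number of grid
    -- points in the prefix, with no rounding error.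
    have hmean : n * uniformSquare.real {z : EuclideanSpace ℝ (Fin 2) |
        blockIndex s K (gridIndex N (z 0)) = i ∧ blockIndex s K (gridIndex N (z 1)) < j} =
        blockSize s K N i * (Finset.univ.filter fun v : Fin N => blockIndex s K v < j).card := by
      rw [uniformSquare_gridIndex hN (fun u => blockIndex s K u = i)
        (fun u => blockIndex s K u < j), hn]
      unfold blockSize
      push_cast
      field_simp
    rw [hmean] at h
    refine h.trans ?_
    have h1 : (blockSize s K N i : ℝ) ≤ 2 * s := by exact_mod_cast blockSize_le hs hKN
    have h2 : ((Finset.univ.filter fun v : Fin N => blockIndex s K v < j).card : ℝ) ≤ N := by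
      exact_mod_cast (Finset.card_le_univ _).trans_eq (Fintype.card_fin N)
    gcongr
  have hsub : {x : Fin n → EuclideanSpace ℝ (Fin 2) | ¬ ∀ i < K, ∀ j ≤ K,
      |((Finset.univ.filter fun p => blockIndex s K (gridIndex N (x p 0)) = i ∧
        blockIndex s K (gridIndex N (x p 1)) < j).card : ℝ) -
        blockSize s K N i * (Finset.univ.filter fun v : Fin N => blockIndex s K v < j).card|
        ≤ d} ⊆ ⋃ a ∈ Finset.range K ×ˢ Finset.range (K + 1), bad a.1 a.2 := by
    intro x hx
    rw [Set.mem_ofPred_eq] at hx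
    push Not at hx
    obtain ⟨i, hi, j, hj, hx⟩ := hx
    simp only [Set.mem_iUnion, exists_prop]
    exact ⟨(i, j), by simp; omega, hx⟩
  refine (measureReal_mono hsub (measure_ne_top _ _)).trans ((measureReal_biUnion_finset_le _ _).trans ?_)
  refine (Finset.sum_le_sum fun a _ => hone a.1 a.2).trans_eq ?_
  rw [Finset.sum_const, Finset.card_product, Finset.card_range, Finset.card_range, nsmul_eq_mul]
  push_cast
  ring

/-- Points of the unit square that are nearly equidistributed span an optimally orthogonally
colourable geometric graph. -/
theorem hasOptimalOrthogonalColouring_geometricGraph {N s K n a : ℕ} (hN : 0 < N) (hs : 0 < s)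
    (hK : 0 < K) (hKN : K = N / s) (hn : n = N ^ 2) {d r : ℝ} (hds : 8 * d ≤ (s : ℝ) ^ 2)
    (hra : r * N + 2 + 6 * s < a) (hrN : (r * N + 2 + 6 * s) * (a + 2) < N)
    (x : Fin n → EuclideanSpace ℝ (Fin 2)) (hx : ∀ p, x p ∈ unitSquare)
    (hd : ∀ i < K, ∀ j ≤ K,
      |((Finset.univ.filter fun p => blockIndex s K (gridIndex N (x p 0)) = i ∧
        blockIndex s K (gridIndex N (x p 1)) < j).card : ℝ) -
        blockSize s K N i * (Finset.univ.filter fun v : Fin N => blockIndex s K v < j).card|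
        ≤ d) :
    HasOptimalOrthogonalColouring (geometricGraph x r) := by
  have hcard : Fintype.card (Fin n) = N ^ 2 := by rw [Fintype.card_fin, hn]
  obtain ⟨f, hf, hclose⟩ := exists_injective_close hN hs hK hKN hcard
    (fun p => (⟨gridIndex N (x p 0), gridIndex_lt hN _⟩, ⟨gridIndex N (x p 1), gridIndex_lt hN _⟩))
    d hds hd
  refine hasOptimalOrthogonalColouring_of_sq hcard
    (hasOrthogonalColouring_of_grid _ hN hra hrN f hf fun u v huv => ?_)
  have hcoord : ∀ i : Fin 2, |x u i * N - x v i * N| ≤ r * N := fun i => by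
    have h := (PiLp.dist_apply_le (x u) (x v) i).trans huv.2.le
    rw [Real.dist_eq] at h
    rw [← sub_mul, abs_mul, abs_of_nonneg (Nat.cast_nonneg N : (0 : ℝ) ≤ N)]
    gcongr
  -- At each end of an edge, rounding costs at most 1 and matching less than `3 * s`.
  have hround : ∀ (i : Fin 2) (y z : ℕ), |(gridIndex N (x u i) : ℝ) - y| < 3 * s →
      |(gridIndex N (x v i) : ℝ) - z| < 3 * s → |(y : ℝ) - z| ≤ r * N + 2 + 6 * s := by
    intro i y z h1 h2
    have hu := gridIndex_bounds hN (hx u i)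
    have hv := gridIndex_bounds hN (hx v i)
    have h3 := abs_le.1 (hcoord i)
    rw [abs_lt] at h1 h2
    rw [abs_le]
    constructor <;> linarith
  exact ⟨hround 0 _ _ (hclose u).1 (hclose v).1, hround 1 _ _ (hclose u).2 (hclose v).2⟩

/-- For `n = N ^ 2` and `r ≤ c / √N` with `c < 1`, the probability that `RG(n, r)` has no optimal
orthogonal colouring is at most `4 N² exp (-ρ √N)`. -/
theorem exists_uniformPoints_lower_bound (c : ℝ) (hc0 : 0 < c) (hc1 : c < 1) :
    ∃ ρ : ℝ, 0 < ρ ∧ ∀ᶠ N : ℕ in atTop, ∀ n : ℕ, n = N ^ 2 → ∀ r : ℝ, r ≤ c / √(N : ℝ) →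
      1 - ENNReal.ofReal (4 * (N : ℝ) ^ 2 * Real.exp (-(ρ * √(N : ℝ)))) ≤
        uniformPoints n {x | HasOptimalOrthogonalColouring (geometricGraph x r)} := by
  -- With `s ≤ ε * w` the matching lengthens edges by at most `6 * ε * w`, half of the slack `(1 -
  -- c) * w`. As `ε * w ≥ 2`, the other half still gives edge bound `w - 10`, enough for `w - 10 <
  -- ⌊√N⌋` and `(w - 10) * (w + 2) < w ^ 2`.
  set ε : ℝ := (1 - c) / 12 with hε
  have hε0 : 0 < ε := by rw [hε]; linarith
  have hε1 : ε < 1 := by rw [hε]; linarith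
  refine ⟨ε ^ 3 / 8192, by positivity, ?_⟩
  have hsqrt : Tendsto (fun N : ℕ => √(N : ℝ)) atTop atTop :=
    Real.tendsto_sqrt_atTop.comp tendsto_natCast_atTop_atTop
  filter_upwards [hsqrt.eventually_ge_atTop 1, hsqrt.eventually_ge_atTop (2 / ε)] with N hN1 hN2
  intro n hn r hr
  set w : ℝ := √(N : ℝ) with hw
  have hw0 : 0 < w := by linarith
  have hww : w * w = N := Real.mul_self_sqrt (Nat.cast_nonneg N)
  have hεw : 2 ≤ ε * w := by
    rw [div_le_iff₀ hε0] at hN2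
    linarith
  have hN0 : 0 < N := by
    have : (0 : ℝ) < N := by rw [← hww]; positivity
    exact_mod_cast this
  set s := ⌊ε * w⌋₊ with hs
  have hs1 : (s : ℝ) ≤ ε * w := Nat.floor_le (by positivity)
  have hs2 : ε * w / 2 ≤ s := by
    have := Nat.lt_floor_add_one (ε * w)
    rw [← hs] at this
    linarith
  have hs0 : 0 < s := by
    have : (0 : ℝ) < s := by linarith
    exact_mod_cast this
  have hsN : s ≤ N := by
    have : (s : ℝ) ≤ N := by
      rw [← hww]
      exact hs1.trans (mul_le_mul_of_nonneg_right (by linarith) hw0.le)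
    exact_mod_cast this
  have hK0 : 0 < N / s := Nat.div_pos hsN hs0
  have hrN : r * N ≤ c * w := by
    calc r * N ≤ c / w * N := by gcongr
      _ = c * w := by rw [← hww]; field_simp
  have ha1 : w < Nat.sqrt N + 1 := by
    have := Real.real_sqrt_lt_nat_sqrt_succ (a := N)
    exact_mod_cast this
  have ha2 : (Nat.sqrt N : ℝ) ≤ w := Real.nat_sqrt_le_real_sqrt
  have hc' : c = 1 - 12 * ε := by rw [hε]; ring
  have hL : r * N + 2 + 6 * s ≤ w - 6 * (ε * w) + 2 := by
    rw [hc'] at hrN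
    nlinarith
  have hL1 : r * N + 2 + 6 * s < Nat.sqrt N := by linarith
  have hL2 : (r * N + 2 + 6 * s) * (Nat.sqrt N + 2) < N := by
    calc (r * N + 2 + 6 * s) * (Nat.sqrt N + 2) ≤ (w - 10) * (Nat.sqrt N + 2) := by
          gcongr
          linarith
      _ < N := by
          rw [← hww]
          rcases le_total w 10 with h | h
          · nlinarith [(Nat.cast_nonneg (Nat.sqrt N) : (0 : ℝ) ≤ Nat.sqrt N)]
          · nlinarith
  -- The largest value for which `s ≥ ε * w / 2` guarantees `8 * d ≤ s ^ 2`.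
  set d : ℝ := ε ^ 2 / 32 * N with hd
  have hds : 8 * d ≤ (s : ℝ) ^ 2 := by
    have : (ε * w / 2) ^ 2 ≤ (s : ℝ) ^ 2 := by gcongr
    rw [hd, ← hww]
    nlinarith
  -- The minimiser of `-(lam * d) + 2 * (ε * w) * N * lam ^ 2`; the minimum is `-(ε ^ 3 / 8192) *
  -- w`.
  set lam : ℝ := ε / 128 / w with hlam
  have hlam0 : 0 < lam := by positivity
  have hlam1 : lam ≤ 1 := by
    rw [hlam, div_le_one hw0]
    linarith
  have hprob := uniformPoints_real_discrepancy_le hN0 hs0 rfl hn lam d hlam0 hlam1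
  have hexp : -(lam * d) + 2 * s * N * lam ^ 2 ≤ -(ε ^ 3 / 8192 * w) := by
    calc -(lam * d) + 2 * s * N * lam ^ 2 ≤ -(lam * d) + 2 * (ε * w) * N * lam ^ 2 := by gcongr
      _ = -(ε ^ 3 / 8192 * w) := by
        rw [hd, hlam, ← hww]
        field_simp
        ring
  have hKN : ((N / s : ℕ) : ℝ) ≤ N := by exact_mod_cast Nat.div_le_self N s
  have hN1' : (1 : ℝ) ≤ N := by exact_mod_cast hN0
  have hbound : ((N / s : ℕ) : ℝ) * (((N / s : ℕ) + 1) *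
      (2 * Real.exp (-(lam * d) + 2 * s * N * lam ^ 2))) ≤
      4 * (N : ℝ) ^ 2 * Real.exp (-(ε ^ 3 / 8192 * w)) := by
    calc _ ≤ (N : ℝ) * ((N + N) * (2 * Real.exp (-(ε ^ 3 / 8192 * w)))) := by gcongr
      _ = _ := by ring
  replace hprob := hprob.trans hbound
  rw [tsub_le_iff_right]
  set bad := {x : Fin n → EuclideanSpace ℝ (Fin 2) | ¬ ∀ i < N / s, ∀ j ≤ N / s,
      |((Finset.univ.filter fun p => blockIndex s (N / s) (gridIndex N (x p 0)) = i ∧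
        blockIndex s (N / s) (gridIndex N (x p 1)) < j).card : ℝ) -
        blockSize s (N / s) N i *
          (Finset.univ.filter fun v : Fin N => blockIndex s (N / s) v < j).card| ≤ d} with hbad
  have hbad' : uniformPoints n bad ≤
      ENNReal.ofReal (4 * (N : ℝ) ^ 2 * Real.exp (-(ε ^ 3 / 8192 * w))) := by
    rw [← ofReal_measureReal]
    exact ENNReal.ofReal_le_ofReal hprob
  -- Covering the space by the two events, up to a null set, uses only subadditivity, so the
  -- colouring event need not be shown measurable.
  calc (1 : ENNReal) = uniformPoints n Set.univ := measure_univ.symm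
    _ ≤ uniformPoints n ({x | HasOptimalOrthogonalColouring (geometricGraph x r)} ∪ bad) := by
        refine measure_mono_ae ?_
        filter_upwards [ae_uniformPoints_mem n] with x hx _
        by_cases hxb : x ∈ bad
        · exact Or.inr hxb
        · refine Or.inl ?_
          rw [hbad, Set.mem_ofPred_eq, not_not] at hxb
          exact hasOptimalOrthogonalColouring_geometricGraph hN0 hs0 hK0 rfl hn hds hL1 hL2 x hx
            hxb
    _ ≤ _ := (measure_union_le _ _).trans (by gcongr)

/-- In terms of `y = ρ √N` this is a constant times `y ^ 4 * exp (-y)`. -/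
theorem tendsto_sq_mul_exp_neg_sqrt {ρ : ℝ} (hρ : 0 < ρ) :
    Tendsto (fun N : ℕ => 4 * (N : ℝ) ^ 2 * Real.exp (-(ρ * √(N : ℝ)))) atTop (𝓝 0) := by
  have hsqrt : Tendsto (fun N : ℕ => ρ * √(N : ℝ)) atTop atTop :=
    (Real.tendsto_sqrt_atTop.comp tendsto_natCast_atTop_atTop).const_mul_atTop hρ
  have h := ((Real.tendsto_pow_mul_exp_neg_atTop_nhds_zero 4).comp hsqrt).const_mul (4 / ρ ^ 4)
  rw [mul_zero] at h
  refine h.congr fun N => ?_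
  have h4 : √(N : ℝ) ^ 4 = (N : ℝ) ^ 2 := by
    rw [show 4 = 2 * 2 from rfl, pow_mul, Real.sq_sqrt (Nat.cast_nonneg N)]
  simp only [Function.comp_apply]
  rw [mul_pow, h4]
  field_simp

/-- Asymptotically almost surely, as `n → ∞` through values `n = m²t²` within the stated range,
`RG(n,r)` has an optimal orthogonal colouring. -/
theorem mainTheorem4 (c : ℝ) (hc0 : 0 < c) (hc1 : c < 1)
    (n m t : ℕ → ℕ) (r : ℕ → ℝ)
    (hn : Tendsto n atTop atTop)
    (hr : ∀ k, r k ≤ c * (n k : ℝ) ^ (-(1 / 4) : ℝ))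
    (hnmt : ∀ k, n k = m k ^ 2 * t k ^ 2)
    (ht_lower : ∀ k, Real.log (n k) ^ 4 ≤ t k)
    (ht_upper : ∀ k, (t k : ℝ) ≤ r k * (n k : ℝ) ^ (1 / 2 : ℝ) / Real.log (n k)) :
    Tendsto
      (fun k => uniformPoints (n k)
        {x | HasOptimalOrthogonalColouring (geometricGraph x (r k))})
      atTop (𝓝 1) := by
  obtain ⟨ρ, hρ, hev⟩ := exists_uniformPoints_lower_bound c hc0 hc1
  have hsq : ∀ k, n k = (m k * t k) ^ 2 := fun k => by rw [hnmt, mul_pow]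
  have hN : Tendsto (fun k => m k * t k) atTop atTop := by
    refine tendsto_atTop.2 fun b => ?_
    filter_upwards [hn.eventually_ge_atTop (b ^ 2)] with k hk
    rw [hsq] at hk
    exact (Nat.pow_le_pow_iff_left two_ne_zero).1 hk
  have hlim : Tendsto (fun k => 1 - ENNReal.ofReal (4 * ((m k * t k : ℕ) : ℝ) ^ 2 *
      Real.exp (-(ρ * √((m k * t k : ℕ) : ℝ))))) atTop (𝓝 1) := by
    have h := ENNReal.tendsto_ofReal ((tendsto_sq_mul_exp_neg_sqrt hρ).comp hN)
    rw [ENNReal.ofReal_zero] at h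
    simpa using ENNReal.Tendsto.sub (tendsto_const_nhds (x := (1 : ENNReal))) h
      (Or.inl ENNReal.one_ne_top)
  refine tendsto_of_tendsto_of_tendsto_of_le_of_le' hlim tendsto_const_nhds ?_
    (Eventually.of_forall fun k => prob_le_one)
  -- The threshold on `N` does not depend on the radius, so `r k` may vary with `k`; here `(N ^ 2) ^
  -- (-1/4) = 1 / √N`.
  filter_upwards [hN.eventually hev] with k hk
  refine hk (n k) (hsq k) (r k) ((hr k).trans_eq ?_)
  rw [hsq, Nat.cast_pow, ← Real.rpow_natCast, ← Real.rpow_mul (Nat.cast_nonneg _),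
    Real.sqrt_eq_rpow, div_eq_mul_inv c, ← Real.rpow_neg (Nat.cast_nonneg _)]
  norm_num
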